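/- Let $\Omega=\{0,1\}^{\mathbb N}$ and let $[x]\subset\Omega$ be the set of infinite extensions of the binary string $x$; $\log$ is the binary logarithm. A probability measure $\mu$ on $\Omega$ is computable if some algorithm, given a string $x$ and a rational $\varepsilon>0$, returns a rational $\varepsilon$-approximation of $\mu([x])$; it is non-atomic if $\mu(\{\omega\})=0$ for all $\omega\in\Omega$. A function from binary strings to $[0,\infty)$ is lower semicomputable if it is the pointwise limit of a nondecreasing computable sequence of rational-valued functions of finite support. A continuous lower semicomputable semimeasure is a lower semicomputable function $a$ from binary strings to $[0,\infty)$ such that $\sum_{x\in S}a(x)\le 1$ for every prefix-free set $S$ of strings. A continuous a priori probability is a continuous lower semicomputable semimeasure $\mathbf a$ that is largest up to a multiplicative constant: for every continuous lower semicomputable semimeasure $b$ there is a constant $C$ with $b(x)\le C\,\mathbf a(x)$ for all $x$. Given $\mathbf a$, put $KA(x)=-\log\mathbf a(x)$ and, writing $\omega_{1\ldots n}$ for the initial segment of $\omega$ of length $n\geq 0$, $$\mathbf d^{A}_\mu(\omega)=\sup_n\{-\log\mu([\omega_{1\ldots n}])-KA(\omega_{1\ldots n})\},\qquad \mathbf d^{\limsup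 A}_\mu(\omega)=\limsup_n\{-\log\mu([\omega_{1\ldots n}])-KA(\omega_{1\ldots n})\}.$$ **Theorem.** A continuous a priori probability exists. Let $\mu$ be a computable non-atomic probability measure on $\Omega$, and let the deficiencies be taken with respect to any continuous a priori probability. Then: 1. For every real constant $c$ there is $\omega\in\Omega$ with $1<\mathbf d^{A}_\mu(\omega)<\infty$ and $$\mathbf d^{\limsup A}_\mu(\omega)<\mathbf d^{A}_\mu(\omega)-\log\mathbf d^{A}_\mu(\omega)-c.$$ 2. The function $2^{\mathbf d^{\limsup A}_\mu}$ is $\mu$-integrable: $\int_\Omega 2^{\mathbf d^{\limsup A}_\mu}\,d\mu<\infty$. 3. The function $2^{\mathbf d^{A}_\mu-\log\mathbf d^{A}_\mu}$ is not $\mu$-integrable, even on the set where it is plainly defined: $\int_{\{1<\mathbf d^{A}_\mu<\infty\}}2^{\mathbf d^{A}_\mu-\log\mathbf d^{A}_\mu}\,d\mu=\infty$. -/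

import Mathlib

open MeasureTheory Filter Topology
open scoped NNReal ENNReal

/-- The Cantor space of infinite binary sequences, with its product (Borel) structure. -/
abbrev CantorSeq : Type := ℕ → Bool

/-- The initial segment of length `n` of `ω`. -/
def initSeg (ω : CantorSeq) (n : ℕ) : List Bool := (List.range n).map ω

/-- The interval `[x]`: all infinite extensions of the string `x`. -/
def cyl (x : List Bool) : Set CantorSeq := {ω | initSeg ω x.length = x}

/-- The nonnegative rational `p / (q + 1)` coded by the pair `(p, q)`. Every nonnegative rational
has such a code. -/
noncomputable def ratVal (r : ℕ × ℕ) : ℝ≥0 := (r.1 : ℝ≥0) / ((r.2 : ℝ≥0) + 1)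

/-- A measure on the Cantor space is computable if an algorithm, given a string `x` and a rational
`ε > 0`, returns a rational `ε`-approximation of the measure of the interval `[x]`. -/
def IsComputableMeasure (μ : Measure CantorSeq) : Prop :=
  ∃ g : List Bool → ℕ × ℕ → ℕ × ℕ, Computable₂ g ∧
    ∀ (x : List Bool) (ε : ℕ × ℕ), 0 < ratVal ε →
      |(ratVal (g x ε) : ℝ) - μ.real (cyl x)| ≤ (ratVal ε : ℝ)

/-- A function from strings to `[0, ∞)` is lower semicomputable if it is the pointwise limit of a
nondecreasing computable sequence of basic functions, i.e. rational-valued functions of finite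
support. -/
def IsLowerSemicomputable (a : List Bool → ℝ≥0) : Prop :=
  ∃ f : ℕ → List Bool → ℕ × ℕ, Computable₂ f ∧
    (∀ n, {x | ratVal (f n x) ≠ 0}.Finite) ∧
    (∀ x, Monotone fun n => ratVal (f n x)) ∧
    ∀ x, Tendsto (fun n => ratVal (f n x)) atTop (𝓝 (a x))

/-- A set of strings is prefix-free if none of its elements is a proper prefix of another one. -/
def IsPrefixFree (S : Set (List Bool)) : Prop :=
  ∀ x ∈ S, ∀ y ∈ S, x <+: y → x = y

/-- A continuous lower semicomputable semimeasure. -/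
def IsContinuousSemimeasure (a : List Bool → ℝ≥0) : Prop :=
  IsLowerSemicomputable a ∧
    ∀ S : Set (List Bool), IsPrefixFree S → ∑' x : S, (a x : ℝ≥0∞) ≤ 1

/-- `a` is a continuous a priori probability: a continuous lower semicomputable semimeasure that is
the largest one up to a multiplicative constant. -/
def IsAPrioriProbability (a : List Bool → ℝ≥0) : Prop :=
  IsContinuousSemimeasure a ∧
    ∀ b : List Bool → ℝ≥0, IsContinuousSemimeasure b → ∃ C : ℝ≥0, ∀ x, b x ≤ C * a x

/-- The binary logarithm `[0, ∞] → [-∞, ∞]`. -/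
noncomputable def log₂ (t : ℝ≥0∞) : EReal := ENNReal.log t / ((Real.log 2 : ℝ) : EReal)

/-- The power `2 ^ s ∈ [0, ∞]` for `s ∈ [-∞, ∞]`. -/
noncomputable def exp₂ (s : EReal) : ℝ≥0∞ := EReal.exp (s * ((Real.log 2 : ℝ) : EReal))

/-- The a priori complexity `KA(x) = -log a(x)` for the a priori probability `a`. -/
noncomputable def complexityKA (a : List Bool → ℝ≥0) (x : List Bool) : EReal :=
  -log₂ (a x : ℝ≥0∞)

/-- `-log μ([ω₁…ωₙ]) - KA(ω₁…ωₙ)`; it is `+∞` if the measure of the interval is zero. -/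
noncomputable def prefixDeficiency (a : List Bool → ℝ≥0) (μ : Measure CantorSeq)
    (ω : CantorSeq) (n : ℕ) : EReal :=
  -log₂ (μ (cyl (initSeg ω n))) - complexityKA a (initSeg ω n)

/-- The a priori deficiency: the supremum over all initial segments. -/
noncomputable def deficiencyA (a : List Bool → ℝ≥0) (μ : Measure CantorSeq)
    (ω : CantorSeq) : EReal :=
  ⨆ n, prefixDeficiency a μ ω n

/-- The limsup a priori deficiency. -/
noncomputable def deficiencyLimsupA (a : List Bool → ℝ≥0) (μ : Measure CantorSeq)
    (ω : CantorSeq) : EReal :=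
  limsup (fun n => prefixDeficiency a μ ω n) atTop

/-! An a priori probability is obtained by running all programs as would-be lower approximations,
freezing a program's approximation whenever the prefix-free inequality visibly fails, and mixing the
results with weights `2⁻ⁱ⁻¹`. A program that really approximates a semimeasure is never frozen, so
the mixture dominates every semimeasure up to a constant.

Wherever the cylinders have positive measure, the deficiencies are the logarithms of the supremum
and the limsup of `a(x) / μ([x])` along `ω`. The definition does not force `a(x0) + a(x1) ≤ a(x)`,
so `a` is replaced by its superadditive majorant `envelope a ≤ 1`. The ratio of the envelope to `μ`
is a nonnegative supermartingale: it converges almost everywhere to a finite limit, whose integral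
is at most 1 by Fatou. This bounds the integral of `2 ^ d^limsup` and makes `d^A < ∞` almost
everywhere.

For the divergence, take a computable path `ξ` whose cylinder measures `mₙ` drop by a factor of at
most 3 per step. The semimeasure concentrated on `ξ` gives `C a(ξ₁…ξₙ) ≥ 1`, so every `ω` that
follows `ξ` for `n` steps has `d^A ≥ sₙ = -log (C mₙ)`. Those leaving at the next step have mass `mₙ
- mₙ₊₁` and contribute at least `(mₙ - mₙ₊₁) / (C mₙ sₙ)` once `sₙ ≥ 2`. These terms behave like
increments of `ln s`, and `sₙ → ∞` because `μ` has no atoms (`tsum_slow_decrease_eq_top`).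

The gap between the deficiencies follows: if it failed for some `c`, then `2 ^ (d^A - log d^A) ≤ 2 ^
c * 2 ^ d^limsup` on `{1 < d^A < ∞}`, bounding a divergent integral by a finite one. -/

theorem IsPrefixFree.mono {S T : Set (List Bool)} (hT : IsPrefixFree T) (h : S ⊆ T) :
    IsPrefixFree S :=
  fun x hx y hy hxy => hT x (h hx) y (h hy) hxy

theorem isPrefixFree_singleton (x : List Bool) : IsPrefixFree {x} := by
  rintro y rfl z rfl _
  rfl

theorem tsum_subtype_le_one_of_forall_finset {a : List Bool → ℝ≥0} {S : Set (List Bool)}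
    (hS : IsPrefixFree S)
    (h : ∀ T : Finset (List Bool), IsPrefixFree (T : Set (List Bool)) → ∑ x ∈ T, a x ≤ 1) :
    ∑' x : S, (a x : ℝ≥0∞) ≤ 1 := by
  rw [ENNReal.tsum_eq_iSup_sum]
  refine iSup_le fun T => ?_
  have h1 : IsPrefixFree ((T.map (Function.Embedding.subtype _) : Finset (List Bool)) :
      Set (List Bool)) := by
    refine hS.mono ?_
    intro x hx
    simp only [Finset.coe_map, Set.mem_image] at hx
    obtain ⟨y, _, rfl⟩ := hx
    exact y.2
  have h2 := h _ h1
  rw [Finset.sum_map] at h2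
  exact_mod_cast h2

theorem IsContinuousSemimeasure.sum_le_one {a : List Bool → ℝ≥0} (ha : IsContinuousSemimeasure a)
    {T : Finset (List Bool)} (hT : IsPrefixFree (T : Set (List Bool))) : ∑ x ∈ T, a x ≤ 1 := by
  have h := ha.2 _ hT
  rw [Finset.tsum_subtype' T (fun x => (a x : ℝ≥0∞))] at h
  exact_mod_cast h

/-- A computable nondecreasing sequence of basic functions whose sums over finite prefix-free sets
are at most one converges to a continuous lower semicomputable semimeasure. -/
theorem exists_isContinuousSemimeasure_of_approx {f : ℕ → List Bool → ℕ × ℕ} (hf : Computable₂ f)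
    (hfin : ∀ n, {x | ratVal (f n x) ≠ 0}.Finite) (hmono : ∀ x, Monotone fun n => ratVal (f n x))
    (hsum : ∀ n, ∀ T : Finset (List Bool), IsPrefixFree (T : Set (List Bool)) →
      ∑ x ∈ T, ratVal (f n x) ≤ 1) :
    ∃ a : List Bool → ℝ≥0, IsContinuousSemimeasure a ∧
      ∀ n x, ratVal (f n x) ≤ a x := by
  have hb : ∀ x, BddAbove (Set.range fun n => ratVal (f n x)) := by
    refine fun x => ⟨1, ?_⟩
    rintro _ ⟨n, rfl⟩
    have := hsum n {x} (by simpa using isPrefixFree_singleton x)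
    simpa using this
  have ht : ∀ x, Tendsto (fun n => ratVal (f n x)) atTop (𝓝 (⨆ n, ratVal (f n x))) :=
    fun x => tendsto_atTop_ciSup (hmono x) (hb x)
  refine ⟨fun x => ⨆ n, ratVal (f n x), ⟨⟨f, hf, hfin, hmono, ht⟩, fun S hS => ?_⟩,
    fun n x => le_ciSup (hb x) n⟩
  refine tsum_subtype_le_one_of_forall_finset (a := fun x => ⨆ n, ratVal (f n x)) hS
    fun T hT => ?_
  exact le_of_tendsto' (tendsto_finsetSum T fun x _ => ht x) fun n => hsum n T hT

/-! ### A universal semimeasure -/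

namespace UniversalSemimeasure

open Nat.Partrec (Code)

/-- The maximum of a list of natural numbers. -/
def listMax (l : List ℕ) : ℕ := l.foldr max 0

theorem listMax_le {l : List ℕ} {b : ℕ} (h : ∀ a ∈ l, a ≤ b) : listMax l ≤ b := by
  induction l with
  | nil => exact Nat.zero_le _
  | cons a l ih =>
    simp only [listMax, List.foldr_cons] at ih ⊢
    exact max_le (h a (by simp)) (ih fun c hc => h c (by simp [hc]))

theorem le_listMax {l : List ℕ} {a : ℕ} (h : a ∈ l) : a ≤ listMax l := by
  induction l with
  | nil => simp at h
  | cons c l ih =>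
    simp only [listMax, List.foldr_cons] at ih ⊢
    rcases List.mem_cons.1 h with rfl | h
    · exact le_max_left _ _
    · exact (ih h).trans (le_max_right _ _)

/-- The strings whose code is less than `n`. -/
def strings (n : ℕ) : List (List Bool) := (List.range n).filterMap (Encodable.decode₂ _)

theorem mem_strings {n : ℕ} {x : List Bool} : x ∈ strings n ↔ Encodable.encode x < n := by
  simp [strings, List.mem_filterMap, Encodable.decode₂_eq_some]

theorem nodup_strings (n : ℕ) : (strings n).Nodup := by
  refine List.Nodup.filterMap ?_ List.nodup_range
  intro k l x hk hl
  rw [Encodable.mem_decode₂] at hk hl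
  rw [← hk, hl]

/-- The lower bound at stage `n`, in units of `2⁻ⁿ`, for the function computed by the `i`-th
program. -/
def guess (i n : ℕ) (x : List Bool) : ℕ :=
  listMax ((List.range (n + 1)).map fun m =>
    (Code.evaln n (Denumerable.ofNat Code i) (Nat.pair m (Encodable.encode x))).getD 0 * 2 ^ (n - m))

/-- No violation of the semimeasure inequality is visible at stage `n`. -/
def Admissible (i n : ℕ) : Prop :=
  ∀ S ∈ (strings n).sublists', (∀ x ∈ S, ∀ y ∈ S, x <+: y → x = y) →
    (S.map (guess i n)).sum ≤ 2 ^ n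

open Classical in
/-- The lower bound at stage `n`, in units of `2⁻ⁿ`, for the `i`-th semimeasure. -/
noncomputable def trimmed (i n : ℕ) (x : List Bool) : ℕ :=
  n.rec 0 fun n r =>
    if Admissible i (n + 1) then (if Encodable.encode x < n + 1 then guess i (n + 1) x else 0)
    else 2 * r

/-- The lower bound at stage `n`, in units of `4⁻ⁿ`, for the weighted sum of all semimeasures. -/
noncomputable def mixture (n : ℕ) (x : List Bool) : ℕ :=
  ((List.range n).map fun i => 2 ^ (n - 1 - i) * trimmed i n x).sum

/-! ### Primitive recursiveness of the construction -/

theorem primrec_listMax : Primrec listMax :=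
  Primrec.list_foldr Primrec.id (Primrec.const 0)
    ((Primrec.nat_max.comp (Primrec.fst.comp Primrec.snd) (Primrec.snd.comp Primrec.snd)).to₂)

theorem primrec_listSum : Primrec (List.sum : List ℕ → ℕ) :=
  (Primrec.list_foldr Primrec.id (Primrec.const 0)
    ((Primrec.nat_add.comp (Primrec.fst.comp Primrec.snd) (Primrec.snd.comp Primrec.snd)).to₂)).of_eq
    fun l => by simp [List.sum_eq_foldr]

theorem primrec_pow : Primrec₂ ((· ^ ·) : ℕ → ℕ → ℕ) :=
  Primrec₂.unpaired'.1 Nat.Primrec.pow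

theorem primrec_strings : Primrec strings :=
  Primrec.listFilterMap Primrec.list_range (Primrec.decode₂.comp Primrec.snd).to₂

theorem primrec_sublists' : Primrec (List.sublists' : List (List Bool) → List (List (List Bool))) := by
  have hc : Primrec₂ (fun (p : List (List Bool) × List Bool × List (List (List Bool)))
      (l : List (List Bool)) => p.2.1 :: l) :=
    (Primrec.list_cons.comp (Primrec.fst.comp (Primrec.snd.comp Primrec.fst)) Primrec.snd).to₂
  have hs : Primrec₂ (fun (_ : List (List Bool)) (p : List Bool × List (List (List Bool))) =>
      p.2 ++ p.2.map (p.1 :: ·)) :=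
    (Primrec.list_append.comp (Primrec.snd.comp Primrec.snd)
      (Primrec.list_map (Primrec.snd.comp Primrec.snd) hc)).to₂
  refine (Primrec.list_foldr Primrec.id (Primrec.const [[]]) hs).of_eq fun l => ?_
  induction l with
  | nil => rfl
  | cons a l ih =>
    simp only [id, List.foldr_cons, List.sublists'_cons] at ih ⊢
    rw [ih]

theorem primrec_guess : Primrec fun p : (ℕ × ℕ) × List Bool => guess p.1.1 p.1.2 p.2 := by
  unfold guess
  refine primrec_listMax.comp (Primrec.list_map
    (Primrec.list_range.comp (Primrec.succ.comp (Primrec.snd.comp Primrec.fst))) ?_)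
  refine Primrec.nat_mul.comp (Primrec.option_getD.comp (Code.primrec_evaln.comp
    (((Primrec.snd.comp (Primrec.fst.comp Primrec.fst)).pair
      ((Primrec.ofNat Code).comp (Primrec.fst.comp (Primrec.fst.comp Primrec.fst)))).pair
      (Primrec₂.natPair.comp Primrec.snd
        (Primrec.encode.comp (Primrec.snd.comp Primrec.fst))))) (Primrec.const 0))
    (primrec_pow.comp (Primrec.const 2) (Primrec.nat_sub.comp
      (Primrec.snd.comp (Primrec.fst.comp Primrec.fst)) Primrec.snd))

theorem primrecPred_prefixFree :
    PrimrecPred fun S : List (List Bool) => ∀ x ∈ S, ∀ y ∈ S, x <+: y → x = y := by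
  have h0 : PrimrecRel fun x y : List Bool => x <+: y → x = y := by
    have h1 : PrimrecRel fun x y : List Bool => x = y.take x.length :=
      Primrec.eq.comp Primrec.fst
        (Primrec.list_take.comp (Primrec.list_length.comp Primrec.fst) Primrec.snd)
    have h2 : PrimrecRel fun x y : List Bool => x = y := Primrec.eq
    refine (h1.not.or h2).of_eq fun p => ?_
    simp only [List.prefix_iff_eq_take, imp_iff_not_or]
  have h1 : PrimrecRel fun (x : List Bool) (S : List (List Bool)) => ∀ y ∈ S, x <+: y → x = y :=
    (PrimrecRel.forall_mem_list h0.swap).swap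
  exact (h1.forall_mem_list).comp Primrec.id Primrec.id

theorem primrecPred_admissible : PrimrecPred fun p : ℕ × ℕ => Admissible p.1 p.2 := by
  have h0 : PrimrecRel fun (S : List (List Bool)) (p : ℕ × ℕ) =>
      (∀ x ∈ S, ∀ y ∈ S, x <+: y → x = y) → (S.map (guess p.1 p.2)).sum ≤ 2 ^ p.2 := by
    have h1 : PrimrecRel fun (S : List (List Bool)) (p : ℕ × ℕ) =>
        (S.map (guess p.1 p.2)).sum ≤ 2 ^ p.2 :=
      Primrec.nat_le.comp
        (primrec_listSum.comp (Primrec.list_map Primrec.fst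
          (primrec_guess.comp ((Primrec.snd.comp Primrec.fst).pair Primrec.snd)).to₂))
        (primrec_pow.comp (Primrec.const 2) (Primrec.snd.comp Primrec.snd))
    have h2 := primrecPred_prefixFree.comp (Primrec.fst (α := List (List Bool)) (β := ℕ × ℕ))
    exact (h2.not.or h1).of_eq fun p => imp_iff_not_or.symm
  exact h0.forall_mem_list.comp (primrec_sublists'.comp (primrec_strings.comp Primrec.snd))
    Primrec.id

theorem primrec_trimmed : Primrec fun p : (ℕ × ℕ) × List Bool => trimmed p.1.1 p.1.2 p.2 := by
  classical
  have hn : Primrec fun q : ((ℕ × ℕ) × List Bool) × ℕ × ℕ => q.2.1 + 1 :=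
    Primrec.succ.comp (Primrec.fst.comp Primrec.snd)
  have hi : Primrec fun q : ((ℕ × ℕ) × List Bool) × ℕ × ℕ => q.1.1.1 :=
    Primrec.fst.comp (Primrec.fst.comp Primrec.fst)
  have hx : Primrec fun q : ((ℕ × ℕ) × List Bool) × ℕ × ℕ => q.1.2 :=
    Primrec.snd.comp Primrec.fst
  exact Primrec.nat_rec' (Primrec.snd.comp Primrec.fst) (Primrec.const 0)
    (Primrec.ite (primrecPred_admissible.comp (hi.pair hn))
      (Primrec.ite (Primrec.nat_lt.comp (Primrec.encode.comp hx) hn)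
        (primrec_guess.comp ((hi.pair hn).pair hx)) (Primrec.const 0))
      (Primrec.nat_mul.comp (Primrec.const 2) (Primrec.snd.comp Primrec.snd))).to₂

theorem primrec_mixture : Primrec₂ mixture := by
  unfold mixture
  have hn : Primrec fun q : (ℕ × List Bool) × ℕ => q.1.1 := Primrec.fst.comp Primrec.fst
  exact (primrec_listSum.comp (Primrec.list_map (Primrec.list_range.comp Primrec.fst)
    (Primrec.nat_mul.comp
      (primrec_pow.comp (Primrec.const 2) (Primrec.nat_sub.comp
        (Primrec.nat_sub.comp hn (Primrec.const 1)) Primrec.snd))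
      (primrec_trimmed.comp ((Primrec.snd.pair hn).pair (Primrec.snd.comp Primrec.fst)))).to₂)).to₂

end UniversalSemimeasure

/-! ### The mixture is a semimeasure and dominates every semimeasure -/

namespace UniversalSemimeasure

open Nat.Partrec (Code)

theorem getD_evaln_mono {m n : ℕ} (h : m ≤ n) (c : Code) (k : ℕ) :
    (Code.evaln m c k).getD 0 ≤ (Code.evaln n c k).getD 0 := by
  cases hv : Code.evaln m c k with
  | none => simp
  | some v => rw [Code.evaln_mono h hv]

theorem two_mul_guess_le (i n : ℕ) (x : List Bool) : 2 * guess i n x ≤ guess i (n + 1) x := by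
  suffices h : guess i n x ≤ guess i (n + 1) x / 2 by omega
  refine listMax_le fun a ha => ?_
  obtain ⟨m, hm, rfl⟩ := List.mem_map.1 ha
  rw [List.mem_range] at hm
  rw [Nat.le_div_iff_mul_le two_pos, mul_assoc, ← pow_succ,
    show n - m + 1 = n + 1 - m by omega]
  refine (Nat.mul_le_mul_right _ (getD_evaln_mono n.le_succ _ _)).trans ?_
  exact le_listMax (List.mem_map.2 ⟨m, List.mem_range.2 (by omega), rfl⟩)

open Classical in
theorem trimmed_le (i n : ℕ) (x : List Bool) :
    trimmed i n x ≤ if Encodable.encode x < n then guess i n x else 0 := by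
  induction n with
  | zero => simp [trimmed]
  | succ n ih =>
    change (if Admissible i (n + 1) then _ else 2 * trimmed i n x) ≤ _
    have h2 := two_mul_guess_le i n x
    split_ifs at ih ⊢ <;> omega

open Classical in
-- Monotonicity in the stage: the unit halves from one stage to the next, so doubling the numerator
-- leaves the value unchanged.
theorem two_mul_trimmed_le (i n : ℕ) (x : List Bool) :
    2 * trimmed i n x ≤ trimmed i (n + 1) x := by
  change _ ≤ (if Admissible i (n + 1) then _ else 2 * trimmed i n x)
  have h := trimmed_le i n x
  have h2 := two_mul_guess_le i n x
  split_ifs at h ⊢ <;> omega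

open Classical in
theorem trimmed_eq_of_admissible {i : ℕ} (h : ∀ n, Admissible i n) (n : ℕ) (x : List Bool) :
    trimmed i n x = if Encodable.encode x < n then guess i n x else 0 := by
  cases n with
  | zero => simp [trimmed]
  | succ n =>
    change (if Admissible i (n + 1) then _ else 2 * trimmed i n x) = _
    rw [if_pos (h _)]

theorem Admissible.sum_le {i n : ℕ} (h : Admissible i n) {T : Finset (List Bool)}
    (hT : IsPrefixFree (T : Set (List Bool))) (hn : ∀ x ∈ T, Encodable.encode x < n) :
    ∑ x ∈ T, guess i n x ≤ 2 ^ n := by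
  have hmem : ∀ x, x ∈ (strings n).filter (· ∈ T) ↔ x ∈ T := by
    intro x
    rw [List.mem_filter, mem_strings, decide_eq_true_eq]
    exact ⟨fun h => h.2, fun h => ⟨hn x h, h⟩⟩
  have h1 := h ((strings n).filter (· ∈ T)) (List.mem_sublists'.2 List.filter_sublist)
    fun x hx y hy => hT x ((hmem x).1 hx) y ((hmem y).1 hy)
  rw [← List.sum_toFinset _ ((nodup_strings n).filter _)] at h1
  convert h1 using 2
  ext x
  rw [List.mem_toFinset, hmem]

/-- At an admissible stage the bound is what was tested; at any other stage the values are frozen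
and the previous bound persists in the new unit. -/
theorem sum_trimmed_le (i n : ℕ) {T : Finset (List Bool)}
    (hT : IsPrefixFree (T : Set (List Bool))) : ∑ x ∈ T, trimmed i n x ≤ 2 ^ n := by
  induction n with
  | zero => simp [trimmed]
  | succ n ih =>
    by_cases h : Admissible i (n + 1)
    · have he : ∀ x, trimmed i (n + 1) x =
          if Encodable.encode x < n + 1 then guess i (n + 1) x else 0 := fun x => if_pos h
      simp_rw [he]
      rw [← Finset.sum_filter]
      refine h.sum_le (hT.mono ?_) fun x hx => (Finset.mem_filter.1 hx).2
      exact_mod_cast Finset.filter_subset _ _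
    · have he : ∀ x, trimmed i (n + 1) x = 2 * trimmed i n x := fun x => if_neg h
      simp_rw [he]
      rw [← Finset.mul_sum, pow_succ']
      exact Nat.mul_le_mul_left 2 ih

theorem mixture_eq_sum (n : ℕ) (x : List Bool) :
    mixture n x = ∑ i ∈ Finset.range n, 2 ^ (n - 1 - i) * trimmed i n x := by
  rw [mixture, ← List.sum_toFinset _ List.nodup_range, List.toFinset_range]

/-- The weight `2⁻ⁱ⁻¹` times the unit `2⁻ⁿ` is `2 ^ (n - 1 - i)` units of `4⁻ⁿ`. Passing to `n + 1`
doubles this coefficient, at least doubles `trimmed`, and adds one new program. -/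
theorem four_mul_mixture_le (n : ℕ) (x : List Bool) :
    4 * mixture n x ≤ mixture (n + 1) x := by
  rw [mixture_eq_sum, mixture_eq_sum, Finset.mul_sum, Finset.sum_range_succ]
  refine le_add_right (Finset.sum_le_sum fun i hi => ?_)
  rw [Finset.mem_range] at hi
  rw [show n + 1 - 1 - i = n - 1 - i + 1 by omega, pow_succ]
  have := Nat.mul_le_mul_left (2 ^ (n - 1 - i) * 2) (two_mul_trimmed_le i n x)
  linarith

theorem sum_mixture_le (n : ℕ) {T : Finset (List Bool)}
    (hT : IsPrefixFree (T : Set (List Bool))) : ∑ x ∈ T, mixture n x ≤ 4 ^ n := by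
  simp_rw [mixture_eq_sum]
  rw [Finset.sum_comm]
  simp_rw [← Finset.mul_sum]
  have hg : ∑ i ∈ Finset.range n, 2 ^ (n - 1 - i) ≤ 2 ^ n := by
    rw [Finset.sum_range_reflect (fun i => 2 ^ i) n]
    exact (Nat.geomSum_lt le_rfl fun i hi => Finset.mem_range.1 hi).le
  calc _ ≤ ∑ i ∈ Finset.range n, 2 ^ (n - 1 - i) * 2 ^ n :=
        Finset.sum_le_sum fun i _ => Nat.mul_le_mul_left _ (sum_trimmed_le i n hT)
    _ ≤ 2 ^ n * 2 ^ n := by rw [← Finset.sum_mul]; exact Nat.mul_le_mul_right _ hg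
    _ = 4 ^ n := by rw [← mul_pow]; norm_num

theorem ratVal_four_pow (k n : ℕ) : ratVal (k, 4 ^ n - 1) = k / 4 ^ n := by
  have h : ((4 ^ n - 1 : ℕ) : ℝ≥0) + 1 = 4 ^ n := by
    have : 4 ^ n - 1 + 1 = 4 ^ n := Nat.sub_add_cancel (Nat.one_le_pow _ _ (by norm_num))
    exact_mod_cast this
  simp only [ratVal, h]

theorem mixture_eq_zero {n : ℕ} {x : List Bool} (h : n ≤ Encodable.encode x) :
    mixture n x = 0 := by
  rw [mixture_eq_sum]
  refine Finset.sum_eq_zero fun i _ => ?_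
  have := trimmed_le i n x
  rw [if_neg (by omega)] at this
  simp [Nat.le_zero.1 this]

theorem exists_semimeasure_ge_mixture :
    ∃ a : List Bool → ℝ≥0, IsContinuousSemimeasure a ∧
      ∀ n x, (mixture n x : ℝ≥0) / 4 ^ n ≤ a x := by
  -- A code `(p, q)` stands for `p / (q + 1)`, so this is `mixture n x / 4 ^ n`.
  have hc : Computable₂ fun n x => (mixture n x, 4 ^ n - 1) :=
    (Primrec.pair primrec_mixture ((Primrec.nat_sub.comp (primrec_pow.comp (Primrec.const 4) Primrec.fst)
      (Primrec.const 1)).to₂)).to_comp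
  have hfin : ∀ n, {x | ratVal (mixture n x, 4 ^ n - 1) ≠ 0}.Finite := by
    intro n
    refine (strings n).toFinset.finite_toSet.subset fun x hx => ?_
    rw [Finset.mem_coe, List.mem_toFinset, mem_strings]
    by_contra h
    refine hx ?_
    simp [ratVal, mixture_eq_zero (not_lt.1 h)]
  have hmono : ∀ x, Monotone fun n => ratVal (mixture n x, 4 ^ n - 1) := by
    intro x
    refine monotone_nat_of_le_succ fun n => ?_
    simp only [ratVal_four_pow]
    rw [div_le_div_iff₀ (by positivity) (by positivity), pow_succ', ← mul_assoc]
    refine mul_le_mul_left ?_ _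
    rw [mul_comm]
    exact_mod_cast four_mul_mixture_le n x
  have hsum : ∀ n, ∀ T : Finset (List Bool), IsPrefixFree (T : Set (List Bool)) →
      ∑ x ∈ T, ratVal (mixture n x, 4 ^ n - 1) ≤ 1 := by
    intro n T hT
    simp only [ratVal_four_pow]
    rw [← Finset.sum_div]
    refine div_le_one_of_le₀ ?_ zero_le
    exact_mod_cast sum_mixture_le n hT
  obtain ⟨a, ha, hle⟩ := exists_isContinuousSemimeasure_of_approx hc hfin hmono hsum
  refine ⟨a, ha, fun n x => ?_⟩
  rw [← ratVal_four_pow]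
  exact hle n x

/-- A computable function is computed by a program, whose guesses are at least its values. -/
theorem exists_code {F : ℕ → List Bool → ℕ} (hF : Computable₂ F) :
    ∃ i : ℕ, (∀ m n x, (Code.evaln n (Denumerable.ofNat Code i)
        (Nat.pair m (Encodable.encode x))).getD 0 ≤ F m x) ∧
      ∀ m x, ∃ k, F m x ∈ Code.evaln k (Denumerable.ofNat Code i)
        (Nat.pair m (Encodable.encode x)) := by
  have h1 : Computable fun k : ℕ =>
      F k.unpair.1 ((Encodable.decode (α := List Bool) k.unpair.2).getD []) :=
    hF.comp (Computable.fst.comp Primrec.unpair.to_comp)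
      (Computable.option_getD (Computable.decode.comp (Computable.snd.comp Primrec.unpair.to_comp))
        (Computable.const []))
  obtain ⟨c, hc⟩ := Code.exists_code.1 (Partrec.nat_iff.1 h1)
  have he : ∀ m x, Code.eval c (Nat.pair m (Encodable.encode x)) = Part.some (F m x) := by
    intro m x
    rw [hc]
    simp
  refine ⟨Encodable.encode c, fun m n x => ?_, fun m x => ?_⟩
  · rw [Denumerable.ofNat_encode]
    cases hv : Code.evaln n c (Nat.pair m (Encodable.encode x)) with
    | none => simp
    | some v =>
      have := Code.evaln_sound hv
      rw [he, Part.mem_some_iff] at this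
      simp [this]
  · rw [Denumerable.ofNat_encode]
    exact Code.evaln_complete.1 (by rw [he]; exact Part.mem_some _)

theorem guess_le {i : ℕ} {b : List Bool → ℝ≥0} {F : ℕ → List Bool → ℕ}
    (hF : ∀ m n x, (Code.evaln n (Denumerable.ofNat Code i)
        (Nat.pair m (Encodable.encode x))).getD 0 ≤ F m x)
    (hb : ∀ m x, (F m x : ℝ≥0) ≤ 2 ^ m * b x) (n : ℕ) (x : List Bool) :
    (guess i n x : ℝ≥0) ≤ 2 ^ n * b x := by
  rw [← Nat.le_floor_iff zero_le]
  refine listMax_le fun a ha => ?_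
  obtain ⟨m, hm, rfl⟩ := List.mem_map.1 ha
  rw [List.mem_range] at hm
  rw [Nat.le_floor_iff zero_le]
  push_cast
  calc _ ≤ (F m x : ℝ≥0) * 2 ^ (n - m) := by gcongr; exact hF m n x
    _ ≤ 2 ^ m * b x * 2 ^ (n - m) := by gcongr; exact hb m x
    _ = 2 ^ n * b x := by
      rw [mul_right_comm, ← pow_add, show m + (n - m) = n by omega]

/-- Guesses lying below a genuine semimeasure inherit its prefix-free inequality. -/
theorem admissible_of_guess_le {i : ℕ} {b : List Bool → ℝ≥0} (hb : IsContinuousSemimeasure b)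
    {n : ℕ} (h : ∀ x, (guess i n x : ℝ≥0) ≤ 2 ^ n * b x) : Admissible i n := by
  intro S hS hpf
  have hnd : S.Nodup := (List.mem_sublists'.1 hS).nodup (nodup_strings n)
  rw [← List.sum_toFinset _ hnd]
  have h1 : ∑ x ∈ S.toFinset, b x ≤ 1 := by
    refine hb.sum_le_one ?_
    intro x hx y hy
    exact hpf x (by simpa using hx) y (by simpa using hy)
  have h2 : ((∑ x ∈ S.toFinset, guess i n x : ℕ) : ℝ≥0) ≤ 2 ^ n := by
    push_cast
    calc _ ≤ ∑ x ∈ S.toFinset, 2 ^ n * b x := Finset.sum_le_sum fun x _ => h x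
      _ ≤ 2 ^ n := by
        rw [← Finset.mul_sum]
        exact mul_le_of_le_one_right zero_le h1
  exact_mod_cast h2

end UniversalSemimeasure

open UniversalSemimeasure in
theorem exists_isAPrioriProbability : ∃ a : List Bool → ℝ≥0, IsAPrioriProbability a := by
  obtain ⟨a, ha, hle⟩ := exists_semimeasure_ge_mixture
  refine ⟨a, ha, fun b hb => ?_⟩
  obtain ⟨f, hf, -, hmono, hlim⟩ := hb.1
  have hfb : ∀ m x, ratVal (f m x) ≤ b x := fun m x => (hmono x).ge_of_tendsto (hlim x) m
  -- Rounding down to multiples of `2⁻ᵐ` gives natural numbers, which is what the programs output.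
  obtain ⟨F, hF⟩ : ∃ F : ℕ → List Bool → ℕ, F = fun m x => 2 ^ m * (f m x).1 / ((f m x).2 + 1) :=
    ⟨_, rfl⟩
  have hFc : Computable₂ F := by
    rw [hF]
    exact Primrec.nat_div.to_comp.comp
      (Primrec.nat_mul.to_comp.comp (primrec_pow.to_comp.comp (Computable.const 2) Computable.fst)
        (Computable.fst.comp hf)) (Computable.succ.comp (Computable.snd.comp hf))
  have hFf : ∀ m x, F m x = ⌊2 ^ m * ratVal (f m x)⌋₊ := by
    intro m x
    rw [hF, ratVal, ← mul_div_assoc]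
    have := Nat.floor_div_eq_div (K := ℝ≥0) (2 ^ m * (f m x).1) ((f m x).2 + 1)
    push_cast at this
    exact this.symm
  have hFb : ∀ m x, (F m x : ℝ≥0) ≤ 2 ^ m * b x := by
    intro m x
    rw [hFf]
    exact (Nat.floor_le zero_le).trans (by gcongr; exact hfb m x)
  obtain ⟨i, hi1, hi2⟩ := exists_code hFc
  have hadm : ∀ n, Admissible i n := fun n => admissible_of_guess_le hb (guess_le hi1 hFb n)
  have hFa : ∀ m x, (F m x : ℝ≥0) ≤ 2 ^ m * (2 ^ (i + 1) * a x) := by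
    intro m x
    obtain ⟨k, hk⟩ := hi2 m x
    -- At stage `n` the computation of `F m x` has halted, program `i` is in the mixture, and `x` is
    -- among the listed strings.
    set n := max (max m k) (max (i + 1) (Encodable.encode x + 1)) with hn
    have h1 : F m x * 2 ^ (n - m) ≤ guess i n x := by
      refine le_listMax (List.mem_map.2 ⟨m, List.mem_range.2 (by omega), ?_⟩)
      rw [Option.mem_def.1 (Nat.Partrec.Code.evaln_mono (show k ≤ n by omega) hk), Option.getD_some]
    have h2 : 2 ^ (n - 1 - i) * (F m x * 2 ^ (n - m)) ≤ mixture n x := by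
      rw [mixture_eq_sum]
      refine le_trans ?_ (Finset.single_le_sum (fun _ _ => Nat.zero_le _)
        (Finset.mem_range.2 (show i < n by omega)))
      rw [trimmed_eq_of_admissible hadm, if_pos (by omega)]
      exact Nat.mul_le_mul_left _ h1
    have h3 := hle n x
    rw [div_le_iff₀ (by positivity)] at h3
    have h4 : (2 : ℝ≥0) ^ (n - 1 - i) * (F m x * 2 ^ (n - m)) ≤ a x * 4 ^ n :=
      le_trans (by exact_mod_cast h2) h3
    have e1 : (4 : ℝ≥0) ^ n = 2 ^ (n - 1 - i) * 2 ^ (n - m) * (2 ^ m * 2 ^ (i + 1)) := by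
      rw [show (4 : ℝ≥0) = 2 ^ 2 by norm_num, ← pow_mul, ← pow_add, ← pow_add, ← pow_add]
      congr 1
      omega
    rw [e1] at h4
    refine le_of_mul_le_mul_left (a := (2 : ℝ≥0) ^ (n - 1 - i) * 2 ^ (n - m)) ?_ (by positivity)
    calc _ = (2 : ℝ≥0) ^ (n - 1 - i) * (F m x * 2 ^ (n - m)) := by ring
      _ ≤ _ := h4
      _ = _ := by ring
  refine ⟨2 ^ (i + 1), fun x => ?_⟩
  -- The rounding error is at most `2⁻ᵐ` and disappears in the limit.
  have hpow : Tendsto (fun m : ℕ => 2 ^ (i + 1) * a x + (1 / 2 : ℝ≥0) ^ m) atTop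
      (𝓝 (2 ^ (i + 1) * a x + 0)) :=
    tendsto_const_nhds.add (NNReal.tendsto_pow_atTop_nhds_zero_of_lt_one (by
      rw [div_lt_one] <;> norm_num))
  rw [add_zero] at hpow
  refine le_of_tendsto_of_tendsto' (hlim x) hpow fun m => ?_
  have h1 : 2 ^ m * ratVal (f m x) ≤ F m x + 1 := by
    rw [hFf]
    exact (Nat.lt_floor_add_one _).le
  refine le_of_mul_le_mul_left (a := (2 : ℝ≥0) ^ m) ?_ (by positivity)
  rw [mul_add, ← mul_pow, mul_one_div_cancel two_ne_zero, one_pow]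
  exact h1.trans (by gcongr; exact hFa m x)

/-! ### Cylinders -/

@[simp] theorem length_initSeg (ω : CantorSeq) (n : ℕ) : (initSeg ω n).length = n := by
  simp [initSeg]

@[simp] theorem initSeg_zero (ω : CantorSeq) : initSeg ω 0 = [] := rfl

theorem initSeg_succ (ω : CantorSeq) (n : ℕ) : initSeg ω (n + 1) = initSeg ω n ++ [ω n] := by
  simp [initSeg, List.range_succ]

theorem take_initSeg {m n : ℕ} (h : m ≤ n) (ω : CantorSeq) :
    (initSeg ω n).take m = initSeg ω m := by
  simp [initSeg, ← List.map_take, List.take_range, h]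

theorem mem_cyl {ω : CantorSeq} {x : List Bool} : ω ∈ cyl x ↔ initSeg ω x.length = x := Iff.rfl

theorem mem_cyl_initSeg (ω : CantorSeq) (n : ℕ) : ω ∈ cyl (initSeg ω n) := by
  simp [mem_cyl]

@[simp] theorem cyl_nil : cyl [] = Set.univ := by
  ext ω
  simp [mem_cyl]

theorem cyl_eq_union (x : List Bool) : cyl x = cyl (x ++ [false]) ∪ cyl (x ++ [true]) := by
  ext ω
  simp only [mem_cyl, Set.mem_union, List.length_append, List.length_singleton, initSeg_succ]
  cases h : ω x.length <;> simp

theorem disjoint_cyl {x y : List Bool} (hl : x.length = y.length) (h : x ≠ y) :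
    Disjoint (cyl x) (cyl y) := by
  refine Set.disjoint_left.2 fun ω hx hy => h ?_
  rw [mem_cyl] at hx hy
  rw [← hx, ← hy, hl]

theorem measurableSet_initSeg_mem (n : ℕ) (T : Set (List Bool)) :
    MeasurableSet {ω : CantorSeq | initSeg ω n ∈ T} := by
  have h1 : Measurable fun ω : CantorSeq => fun i : Fin n => ω i := by fun_prop
  have h2 : {ω : CantorSeq | initSeg ω n ∈ T} =
      (fun ω : CantorSeq => fun i : Fin n => ω i) ⁻¹' {v | List.ofFn v ∈ T} := by
    ext ω
    have : initSeg ω n = List.ofFn fun i : Fin n => ω i := by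
      refine List.ext_getElem (by simp) fun i hi _ => ?_
      simp [initSeg]
    simp [this]
  rw [h2]
  exact h1 (Set.toFinite _).measurableSet

theorem measurableSet_cyl (x : List Bool) : MeasurableSet (cyl x) :=
  measurableSet_initSeg_mem x.length {x}

theorem measurable_comp_initSeg {β : Type*} [MeasurableSpace β] (f : List Bool → β) (n : ℕ) :
    Measurable fun ω : CantorSeq => f (initSeg ω n) :=
  fun s _ => measurableSet_initSeg_mem n (f ⁻¹' s)

theorem setOf_initSeg_mem_eq_biUnion (n : ℕ) (T : Set (List Bool)) :
    {ω : CantorSeq | initSeg ω n ∈ T} = ⋃ x ∈ {x ∈ T | x.length = n}, cyl x := by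
  ext ω
  simp only [Set.mem_ofPred_eq, Set.mem_iUnion, mem_cyl, exists_prop]
  constructor
  · exact fun h => ⟨_, ⟨h, length_initSeg ω n⟩, by simp⟩
  · rintro ⟨x, ⟨hx, rfl⟩, h⟩
    rwa [h]

theorem lintegral_initSeg_mem (μ : Measure CantorSeq) (n : ℕ) (T : Set (List Bool))
    (f : CantorSeq → ℝ≥0∞) :
    ∫⁻ ω in {ω | initSeg ω n ∈ T}, f ω ∂μ =
      ∑' x : {x ∈ T | x.length = n}, ∫⁻ ω in cyl x, f ω ∂μ := by
  rw [setOf_initSeg_mem_eq_biUnion]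
  refine lintegral_biUnion (Set.to_countable _) (fun x _ => measurableSet_cyl x) ?_ f
  intro x hx y hy hxy
  exact disjoint_cyl (hx.2.trans hy.2.symm) hxy

theorem setLIntegral_cyl (μ : Measure CantorSeq) (f : List Bool → ℝ≥0∞) (x : List Bool) :
    ∫⁻ ω in cyl x, f (initSeg ω x.length) ∂μ = f x * μ (cyl x) := by
  rw [setLIntegral_congr_fun (g := fun _ => f x) (measurableSet_cyl x)
    (fun ω (hω : ω ∈ cyl x) => by simp only [mem_cyl.1 hω]), setLIntegral_const]

theorem setLIntegral_cyl_succ (μ : Measure CantorSeq) (f : List Bool → ℝ≥0∞) (x : List Bool) :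
    ∫⁻ ω in cyl x, f (initSeg ω (x.length + 1)) ∂μ =
      f (x ++ [false]) * μ (cyl (x ++ [false])) + f (x ++ [true]) * μ (cyl (x ++ [true])) := by
  have h := setLIntegral_cyl μ f (x ++ [false])
  have h' := setLIntegral_cyl μ f (x ++ [true])
  rw [List.length_append, List.length_singleton] at h h'
  rw [cyl_eq_union x, lintegral_union (measurableSet_cyl _) (disjoint_cyl (by simp) (by simp)), h,
    h']

theorem ae_measure_cyl_ne_zero (μ : Measure CantorSeq) :
    ∀ᵐ ω ∂μ, ∀ n, μ (cyl (initSeg ω n)) ≠ 0 := by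
  refine ae_all_iff.2 fun n => ?_
  rw [ae_iff]
  refine measure_mono_null (t := ⋃ x ∈ {x : List Bool | μ (cyl x) = 0}, cyl x) ?_ ?_
  · intro ω hω
    exact Set.mem_biUnion (x := initSeg ω n) (not_not.1 hω) (mem_cyl_initSeg ω n)
  · exact (measure_biUnion_null_iff (Set.to_countable _)).2 fun x hx => hx

/-! ### The ratio of a supermeasure and a measure -/

/-- The filtration of the Cantor space by the initial segments. -/
def prefixFiltration : Filtration ℕ (inferInstance : MeasurableSpace CantorSeq) where
  seq n := MeasurableSpace.comap (fun ω => initSeg ω n) ⊤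
  mono' m n h := by
    rintro _ ⟨T, -, rfl⟩
    refine ⟨List.take m ⁻¹' T, trivial, ?_⟩
    ext ω
    simp [take_initSeg h]
  le' n := by
    rintro _ ⟨T, -, rfl⟩
    exact measurableSet_initSeg_mem n T

section Supermeasure

variable {μ : Measure CantorSeq} {ν : List Bool → ℝ≥0∞}

/-- The real-valued ratio `ν(x) / μ([x])`, zero if `μ([x]) = 0`. -/
noncomputable def realRatio (μ : Measure CantorSeq) (ν : List Bool → ℝ≥0∞) (x : List Bool) : ℝ :=
  (ν x / μ (cyl x)).toReal

theorem realRatio_nonneg (x : List Bool) : 0 ≤ realRatio μ ν x := ENNReal.toReal_nonneg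

theorem ofReal_realRatio (hν : ∀ x, ν x ≠ ⊤) {x : List Bool} (hx : μ (cyl x) ≠ 0) :
    ENNReal.ofReal (realRatio μ ν x) = ν x / μ (cyl x) :=
  ENNReal.ofReal_toReal (ENNReal.div_ne_top (hν x) hx)

variable [IsProbabilityMeasure μ]

theorem ofReal_realRatio_mul (hν : ∀ x, ν x ≠ ⊤) {x : List Bool} (hx : μ (cyl x) ≠ 0) :
    ENNReal.ofReal (realRatio μ ν x) * μ (cyl x) = ν x := by
  rw [ofReal_realRatio hν hx, ENNReal.div_mul_cancel hx (measure_ne_top _ _)]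

theorem ofReal_realRatio_mul_le (hν : ∀ x, ν x ≠ ⊤) (x : List Bool) :
    ENNReal.ofReal (realRatio μ ν x) * μ (cyl x) ≤ ν x := by
  by_cases hx : μ (cyl x) = 0
  · simp [hx]
  · exact (ofReal_realRatio_mul hν hx).le

/-- The supermartingale inequality, checked on each cylinder: if `μ([x]) > 0`, the left side is at
most `ν(x0) + ν(x1)` and the right side is `ν(x)`; if `μ([x]) = 0`, both vanish. -/
theorem setLIntegral_realRatio_succ_le (hν : ∀ x, ν x ≠ ⊤)
    (hadd : ∀ x, ν (x ++ [false]) + ν (x ++ [true]) ≤ ν x) (n : ℕ) (T : Set (List Bool)) :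
    ∫⁻ ω in {ω | initSeg ω n ∈ T}, ENNReal.ofReal (realRatio μ ν (initSeg ω (n + 1))) ∂μ ≤
      ∫⁻ ω in {ω | initSeg ω n ∈ T}, ENNReal.ofReal (realRatio μ ν (initSeg ω n)) ∂μ := by
  rw [lintegral_initSeg_mem, lintegral_initSeg_mem]
  refine ENNReal.tsum_le_tsum ?_
  rintro ⟨x, -, rfl⟩
  rw [setLIntegral_cyl_succ μ (fun x => ENNReal.ofReal (realRatio μ ν x)),
    setLIntegral_cyl μ (fun x => ENNReal.ofReal (realRatio μ ν x))]
  by_cases hx : μ (cyl x) = 0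
  · have h0 : μ (cyl (x ++ [false])) = 0 :=
      measure_mono_null (by rw [cyl_eq_union x]; exact Set.subset_union_left) hx
    have h1 : μ (cyl (x ++ [true])) = 0 :=
      measure_mono_null (by rw [cyl_eq_union x]; exact Set.subset_union_right) hx
    simp [h0, h1]
  · rw [ofReal_realRatio_mul hν hx]
    exact (add_le_add (ofReal_realRatio_mul_le hν _) (ofReal_realRatio_mul_le hν _)).trans (hadd x)

theorem lintegral_realRatio_le (hν : ∀ x, ν x ≠ ⊤)
    (hadd : ∀ x, ν (x ++ [false]) + ν (x ++ [true]) ≤ ν x) (n : ℕ) :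
    ∫⁻ ω, ENNReal.ofReal (realRatio μ ν (initSeg ω n)) ∂μ ≤ ν [] := by
  induction n with
  | zero =>
    simp only [initSeg_zero, lintegral_const, measure_univ, mul_one]
    simpa using ofReal_realRatio_mul_le (μ := μ) hν []
  | succ n ih =>
    refine le_trans ?_ ih
    simpa using setLIntegral_realRatio_succ_le (μ := μ) hν hadd n Set.univ

theorem supermartingale_realRatio (hν : ∀ x, ν x ≠ ⊤)
    (hadd : ∀ x, ν (x ++ [false]) + ν (x ++ [true]) ≤ ν x) :
    Supermartingale (fun n ω => realRatio μ ν (initSeg ω n)) prefixFiltration μ := by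
  have hm : ∀ n, Measurable fun ω : CantorSeq => realRatio μ ν (initSeg ω n) :=
    measurable_comp_initSeg _
  have hfin : ∀ n, ∫⁻ ω, ENNReal.ofReal (realRatio μ ν (initSeg ω n)) ∂μ < ⊤ := fun n =>
    (lintegral_realRatio_le hν hadd n).trans_lt (hν []).lt_top
  have hnn : ∀ n, 0 ≤ fun ω : CantorSeq => realRatio μ ν (initSeg ω n) :=
    fun n ω => realRatio_nonneg _
  have hint : ∀ n, Integrable (fun ω => realRatio μ ν (initSeg ω n)) μ := by
    refine fun n => ⟨(hm n).aestronglyMeasurable, ?_⟩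
    rw [hasFiniteIntegral_iff_ofReal (ae_of_all _ (hnn n))]
    exact hfin n
  refine supermartingale_of_setIntegral_succ_le (fun n => ?_) hint ?_
  · refine Measurable.stronglyMeasurable ?_
    intro s _
    exact ⟨realRatio μ ν ⁻¹' s, trivial, rfl⟩
  · rintro n _ ⟨T, -, rfl⟩
    rw [integral_eq_lintegral_of_nonneg_ae (ae_of_all _ (hnn _)) (hm _).aestronglyMeasurable,
      integral_eq_lintegral_of_nonneg_ae (ae_of_all _ (hnn _)) (hm _).aestronglyMeasurable]
    refine ENNReal.toReal_mono ?_ (setLIntegral_realRatio_succ_le hν hadd n T)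
    exact ((setLIntegral_le_lintegral _ _).trans_lt (hfin n)).ne

/-- Doob's convergence theorem, applied to the negated ratio, an `L¹`-bounded submartingale. -/
theorem ae_tendsto_ratio (hν : ∀ x, ν x ≠ ⊤)
    (hadd : ∀ x, ν (x ++ [false]) + ν (x ++ [true]) ≤ ν x) :
    ∀ᵐ ω ∂μ, ∃ c : ℝ≥0∞, c ≠ ⊤ ∧
      Tendsto (fun n => ν (initSeg ω n) / μ (cyl (initSeg ω n))) atTop (𝓝 c) := by
  have hb : ∀ n, eLpNorm ((-fun n (ω : CantorSeq) => realRatio μ ν (initSeg ω n)) n) 1 μ ≤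
      ((ν []).toNNReal : ℝ≥0) := by
    intro n
    rw [eLpNorm_one_eq_lintegral_enorm, ENNReal.coe_toNNReal (hν [])]
    refine le_trans (le_of_eq ?_) (lintegral_realRatio_le (μ := μ) hν hadd n)
    refine lintegral_congr fun ω => ?_
    rw [Pi.neg_apply, Pi.neg_apply, enorm_neg, Real.enorm_of_nonneg (realRatio_nonneg _)]
  filter_upwards [(supermartingale_realRatio hν hadd).neg.exists_ae_tendsto_of_bdd hb,
    ae_measure_cyl_ne_zero μ] with ω ⟨c, hc⟩ hpos
  refine ⟨ENNReal.ofReal (-c), ENNReal.ofReal_ne_top, ?_⟩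
  refine (ENNReal.tendsto_ofReal hc.neg).congr fun n => ?_
  simp only [Pi.neg_apply, neg_neg]
  exact ofReal_realRatio hν (hpos n)

/-- Almost everywhere convergence turns the limsup into a liminf, to which Fatou's lemma applies. -/
theorem lintegral_limsup_ratio_le (hν : ∀ x, ν x ≠ ⊤)
    (hadd : ∀ x, ν (x ++ [false]) + ν (x ++ [true]) ≤ ν x) :
    ∫⁻ ω, limsup (fun n => ν (initSeg ω n) / μ (cyl (initSeg ω n))) atTop ∂μ ≤ ν [] := by
  calc _ ≤ ∫⁻ ω, liminf (fun n => ENNReal.ofReal (realRatio μ ν (initSeg ω n))) atTop ∂μ := by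
        refine lintegral_mono_ae ?_
        filter_upwards [ae_tendsto_ratio (μ := μ) hν hadd, ae_measure_cyl_ne_zero μ]
          with ω ⟨c, _, hc⟩ hpos
        simp only [ofReal_realRatio hν (hpos _)]
        rw [hc.limsup_eq, hc.liminf_eq]
    _ ≤ liminf (fun n => ∫⁻ ω, ENNReal.ofReal (realRatio μ ν (initSeg ω n)) ∂μ) atTop :=
        lintegral_liminf_le fun n => measurable_comp_initSeg (fun x => ENNReal.ofReal (realRatio μ ν x)) n
    _ ≤ ν [] := by
        refine (liminf_le_liminf (Eventually.of_forall fun n =>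
          lintegral_realRatio_le hν hadd n)).trans ?_
        simp

end Supermeasure

/-! ### The least supermeasure above a semimeasure -/

/-- The supremum of the sums of `a` over the finite prefix-free sets of extensions of `x`. -/
noncomputable def envelope (a : List Bool → ℝ≥0) (x : List Bool) : ℝ≥0∞ :=
  ⨆ S : {S : Finset (List Bool) // IsPrefixFree (S : Set (List Bool)) ∧ ∀ y ∈ S, x <+: y},
    ∑ y ∈ S.1, (a y : ℝ≥0∞)

theorem le_envelope (a : List Bool → ℝ≥0) (x : List Bool) : (a x : ℝ≥0∞) ≤ envelope a x := by
  refine le_trans ?_ (le_iSup _ ⟨{x}, by simpa using isPrefixFree_singleton x, by simp⟩)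
  simp

theorem envelope_le_one {a : List Bool → ℝ≥0} (ha : IsContinuousSemimeasure a) (x : List Bool) :
    envelope a x ≤ 1 :=
  iSup_le fun S => by exact_mod_cast ha.sum_le_one S.2.1

/-- Prefix-free sets above `x0` and above `x1` have a prefix-free union above `x`. -/
theorem envelope_add_le (a : List Bool → ℝ≥0) (x : List Bool) :
    envelope a (x ++ [false]) + envelope a (x ++ [true]) ≤ envelope a x := by
  have hne : ∀ y, Nonempty {S : Finset (List Bool) //
      IsPrefixFree (S : Set (List Bool)) ∧ ∀ z ∈ S, y <+: z} :=
    fun y => ⟨⟨∅, by simp [IsPrefixFree], by simp⟩⟩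
  have := hne (x ++ [false])
  have := hne (x ++ [true])
  have hcl : ∀ z : List Bool, x ++ [false] <+: z → ¬ x ++ [true] <+: z := by
    intro z h0 h1
    have := List.prefix_of_prefix_length_le h0 h1 (by simp)
    simp at this
  have hno : ∀ (b c : Bool) (y z : List Bool), b ≠ c → x ++ [b] <+: y → x ++ [c] <+: z →
      ¬ y <+: z := by
    intro b c y z hbc hy hz hyz
    have h := List.prefix_of_prefix_length_le (hy.trans hyz) hz (by simp)
    simp [hbc] at h
  refine ENNReal.iSup_add_iSup_le ?_
  rintro ⟨S, hS, hSx⟩ ⟨T, hT, hTx⟩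
  have hd : Disjoint S T := Finset.disjoint_left.2 fun z h0 h1 => hcl z (hSx z h0) (hTx z h1)
  classical
  rw [← Finset.sum_union hd]
  refine le_iSup (fun S : {S : Finset (List Bool) //
    IsPrefixFree (S : Set (List Bool)) ∧ ∀ y ∈ S, x <+: y} => ∑ y ∈ S.1, (a y : ℝ≥0∞))
    ⟨S ∪ T, ?_, ?_⟩
  · intro y hy z hz hyz
    rw [Finset.mem_coe, Finset.mem_union] at hy hz
    rcases hy with hy | hy <;> rcases hz with hz | hz
    · exact hS y hy z hz hyz
    · exact absurd hyz (hno _ _ y z (by simp) (hSx y hy) (hTx z hz))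
    · exact absurd hyz (hno _ _ y z (by simp) (hTx y hy) (hSx z hz))
    · exact hT y hy z hz hyz
  · intro y hy
    rcases Finset.mem_union.1 hy with hy | hy
    · exact (List.prefix_append _ _).trans (hSx y hy)
    · exact (List.prefix_append _ _).trans (hTx y hy)

theorem lintegral_limsup_semimeasure_ratio_le (μ : Measure CantorSeq) [IsProbabilityMeasure μ]
    {a : List Bool → ℝ≥0} (ha : IsContinuousSemimeasure a) :
    ∫⁻ ω, limsup (fun n => (a (initSeg ω n) : ℝ≥0∞) / μ (cyl (initSeg ω n))) atTop ∂μ ≤ 1 := by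
  refine le_trans (lintegral_mono fun ω => ?_) ((lintegral_limsup_ratio_le (μ := μ)
    (ν := envelope a) (fun x => ((envelope_le_one ha x).trans_lt ENNReal.one_lt_top).ne)
    (envelope_add_le a)).trans (envelope_le_one ha []))
  exact limsup_le_limsup (Eventually.of_forall fun n =>
    ENNReal.div_le_div_right (le_envelope a _) _)

/-- The envelope ratio converges to a finite `c`, so its tail is below `c + 1`; the finitely many
other terms are finite. -/
theorem ae_iSup_semimeasure_ratio_lt_top (μ : Measure CantorSeq) [IsProbabilityMeasure μ]
    {a : List Bool → ℝ≥0} (ha : IsContinuousSemimeasure a) :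
    ∀ᵐ ω ∂μ, ⨆ n, (a (initSeg ω n) : ℝ≥0∞) / μ (cyl (initSeg ω n)) < ⊤ := by
  have hν : ∀ x, envelope a x ≠ ⊤ := fun x =>
    ((envelope_le_one ha x).trans_lt ENNReal.one_lt_top).ne
  filter_upwards [ae_tendsto_ratio (μ := μ) hν (envelope_add_le a), ae_measure_cyl_ne_zero μ]
    with ω ⟨c, hct, hc⟩ hpos
  obtain ⟨N, hN⟩ := eventually_atTop.1 (hc.eventually_lt_const
    (show c < c + 1 from ENNReal.lt_add_right hct one_ne_zero))
  have hlt : ∀ n, envelope a (initSeg ω n) / μ (cyl (initSeg ω n)) < ⊤ := fun n =>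
    (ENNReal.div_ne_top (hν _) (hpos n)).lt_top
  refine lt_of_le_of_lt (b := (c + 1) ⊔ (Finset.range N).sup fun n =>
    envelope a (initSeg ω n) / μ (cyl (initSeg ω n))) (iSup_le fun n => ?_) ?_
  · refine (ENNReal.div_le_div_right (le_envelope a _) _).trans ?_
    rcases lt_or_ge n N with h | h
    · exact le_sup_of_le_right (Finset.le_sup (f := fun n =>
        envelope a (initSeg ω n) / μ (cyl (initSeg ω n))) (Finset.mem_range.2 h))
    · exact le_sup_of_le_left (hN n h).le
  · refine max_lt (ENNReal.add_lt_top.2 ⟨hct.lt_top, ENNReal.one_lt_top⟩) ?_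
    exact (Finset.sup_lt_iff ENNReal.zero_lt_top).2 fun n _ => hlt n

/-! ### A computable path along which the measure decreases slowly -/

theorem measureReal_cyl_eq_add (μ : Measure CantorSeq) [IsProbabilityMeasure μ] (x : List Bool) :
    μ.real (cyl x) = μ.real (cyl (x ++ [false])) + μ.real (cyl (x ++ [true])) := by
  conv_lhs => rw [cyl_eq_union x]
  exact measureReal_union (disjoint_cyl (by simp) (by simp)) (measurableSet_cyl _)

/-- The comparison of the rationals coded by two pairs. -/
def ratCodeLE (p q : ℕ × ℕ) : Bool := decide (p.1 * (q.2 + 1) ≤ q.1 * (p.2 + 1))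

theorem ratCodeLE_iff {p q : ℕ × ℕ} : ratCodeLE p q = true ↔ ratVal p ≤ ratVal q := by
  rw [ratCodeLE, decide_eq_true_eq, ratVal, ratVal, div_le_div_iff₀ (by positivity) (by positivity)]
  exact_mod_cast Iff.rfl

theorem primrec_ratCodeLE : Primrec₂ ratCodeLE :=
  (Primrec.nat_le.comp
    (Primrec.nat_mul.comp (Primrec.fst.comp Primrec.fst)
      (Primrec.succ.comp (Primrec.snd.comp Primrec.snd)))
    (Primrec.nat_mul.comp (Primrec.fst.comp Primrec.snd)
      (Primrec.succ.comp (Primrec.snd.comp Primrec.fst)))).decide.to₂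

/-- The path that always moves to the child whose approximate measure `g` is larger. -/
def heavyPath (g : List Bool → ℕ × ℕ → ℕ × ℕ) (n : ℕ) : List Bool :=
  n.rec [] fun n x =>
    x ++ [ratCodeLE (g (x ++ [false]) (1, 6 * 3 ^ n)) (g (x ++ [true]) (1, 6 * 3 ^ n))]

theorem computable_heavyPath {g : List Bool → ℕ × ℕ → ℕ × ℕ} (hg : Computable₂ g) :
    Computable (heavyPath g) := by
  have hx : Computable fun q : ℕ × ℕ × List Bool => q.2.2 := Computable.snd.comp Computable.snd
  have he : Computable fun q : ℕ × ℕ × List Bool => ((1, 6 * 3 ^ q.2.1) : ℕ × ℕ) :=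
    (Computable.const 1).pair (Primrec.nat_mul.to_comp.comp (Computable.const 6)
      (UniversalSemimeasure.primrec_pow.to_comp.comp (Computable.const 3)
        (Computable.fst.comp Computable.snd)))
  have hc : ∀ b : Bool, Computable fun q : ℕ × ℕ × List Bool => q.2.2 ++ [b] := fun b =>
    Primrec.list_concat.to_comp.comp hx (Computable.const b)
  exact Computable.nat_rec Computable.id (Computable.const [])
    (Primrec.list_concat.to_comp.comp hx (primrec_ratCodeLE.to_comp.comp
      (hg.comp (hc false) he) (hg.comp (hc true) he))).to₂

/-- Choosing the apparently heavier child of a cylinder of measure `m`, with error `ε` in each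
approximation, leaves at least `m / 2 - ε`. This is at least `m / 3` when `ε ≤ m / 6`; the precision
`3⁻ⁿ / 6` suffices because inductively `m ≥ 3⁻ⁿ`. -/
theorem exists_computable_slow_path (μ : Measure CantorSeq) [IsProbabilityMeasure μ]
    (hμ : IsComputableMeasure μ) :
    ∃ ω : CantorSeq, (Computable fun n => initSeg ω n) ∧ ∀ n,
      0 < μ.real (cyl (initSeg ω n)) ∧
      μ.real (cyl (initSeg ω n)) ≤ 3 * μ.real (cyl (initSeg ω (n + 1))) := by
  obtain ⟨g, hg, happ⟩ := hμ
  let ω : CantorSeq := fun n => ratCodeLE (g (heavyPath g n ++ [false]) (1, 6 * 3 ^ n))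
    (g (heavyPath g n ++ [true]) (1, 6 * 3 ^ n))
  have hω : ∀ n, initSeg ω n = heavyPath g n := by
    intro n
    induction n with
    | zero => rfl
    | succ n ih => rw [initSeg_succ, ih]; rfl
  have hstep : ∀ n, (1 / 3 : ℝ) ^ n ≤ μ.real (cyl (initSeg ω n)) →
      μ.real (cyl (initSeg ω n)) ≤ 3 * μ.real (cyl (initSeg ω (n + 1))) := by
    intro n hn
    have hε : (ratVal (1, 6 * 3 ^ n) : ℝ) ≤ (1 / 3 : ℝ) ^ n / 6 := by
      simp only [ratVal]
      push_cast
      rw [one_div_pow, div_div, div_le_div_iff₀ (by positivity) (by positivity)]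
      linarith
    have hε0 : 0 < ratVal (1, 6 * 3 ^ n) := by
      simp only [ratVal]
      positivity
    rw [initSeg_succ]
    have hsum := measureReal_cyl_eq_add μ (initSeg ω n)
    have h0 := abs_le.1 (happ (initSeg ω n ++ [false]) _ hε0)
    have h1 := abs_le.1 (happ (initSeg ω n ++ [true]) _ hε0)
    have hdef : ω n = ratCodeLE (g (initSeg ω n ++ [false]) (1, 6 * 3 ^ n))
        (g (initSeg ω n ++ [true]) (1, 6 * 3 ^ n)) := by
      rw [hω]
    cases hv : ω n with
    | true =>
      rw [hv] at hdef
      have hle : (ratVal (g (initSeg ω n ++ [false]) (1, 6 * 3 ^ n)) : ℝ) ≤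
          ratVal (g (initSeg ω n ++ [true]) (1, 6 * 3 ^ n)) :=
        NNReal.coe_le_coe.2 (ratCodeLE_iff.1 hdef.symm)
      linarith [h0.1, h0.2, h1.1, h1.2]
    | false =>
      rw [hv] at hdef
      have hle : (ratVal (g (initSeg ω n ++ [true]) (1, 6 * 3 ^ n)) : ℝ) ≤
          ratVal (g (initSeg ω n ++ [false]) (1, 6 * 3 ^ n)) := by
        refine NNReal.coe_le_coe.2 (le_of_not_ge fun h => ?_)
        rw [ratCodeLE_iff.2 h] at hdef
        cases hdef
      linarith [h0.1, h0.2, h1.1, h1.2]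
  have hlow : ∀ n, (1 / 3 : ℝ) ^ n ≤ μ.real (cyl (initSeg ω n)) := by
    intro n
    induction n with
    | zero => simp
    | succ n ih =>
      have := hstep n ih
      rw [pow_succ]
      linarith
  exact ⟨ω, (computable_heavyPath hg).of_eq fun n => (hω n).symm,
    fun n => ⟨lt_of_lt_of_le (by positivity) (hlow n), hstep n (hlow n)⟩⟩

/-- The semimeasure concentrated on a computable sequence. -/
theorem exists_semimeasure_concentrated {ω : CantorSeq} (hω : Computable fun n => initSeg ω n) :
    ∃ b : List Bool → ℝ≥0, IsContinuousSemimeasure b ∧ ∀ n, 1 ≤ b (initSeg ω n) := by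
  let f : ℕ → List Bool → ℕ × ℕ := fun n x =>
    bif decide (Encodable.encode x < n) then
      (bif decide (x = initSeg ω x.length) then (1, 0) else (0, 0)) else (0, 0)
  have hfval : ∀ n x, ratVal (f n x) =
      if Encodable.encode x < n ∧ x = initSeg ω x.length then 1 else 0 := by
    intro n x
    simp only [f]
    rw [← Bool.cond_decide, Bool.decide_and]
    cases decide (Encodable.encode x < n) <;> cases decide (x = initSeg ω x.length) <;>
      simp [ratVal]
  have hf : Computable₂ f := by
    have h1 : Computable fun p : ℕ × List Bool => decide (Encodable.encode p.2 < p.1) :=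
      (Primrec.nat_lt.comp (Primrec.encode.comp Primrec.snd) Primrec.fst).decide.to_comp
    have h2 : Computable fun p : ℕ × List Bool => decide (p.2 = initSeg ω p.2.length) :=
      (Primrec.eq (α := List Bool)).decide.to_comp.comp Computable.snd
        (hω.comp (Computable.list_length.comp Computable.snd))
    exact (Computable.cond h1 (Computable.cond h2 (Computable.const (1, 0))
      (Computable.const (0, 0))) (Computable.const (0, 0))).to₂
  have hfin : ∀ n, {x | ratVal (f n x) ≠ 0}.Finite := by
    intro n
    refine (UniversalSemimeasure.strings n).toFinset.finite_toSet.subset fun x hx => ?_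
    rw [Finset.mem_coe, List.mem_toFinset, UniversalSemimeasure.mem_strings]
    by_contra h
    exact hx (by rw [hfval, if_neg fun h' => h h'.1])
  have hmono : ∀ x, Monotone fun n => ratVal (f n x) := by
    intro x m n hmn
    simp only [hfval]
    split_ifs with h1 h2
    · exact le_rfl
    · exact absurd ⟨h1.1.trans_le hmn, h1.2⟩ h2
    · exact zero_le_one
    · exact le_rfl
  have hsum : ∀ n, ∀ T : Finset (List Bool), IsPrefixFree (T : Set (List Bool)) →
      ∑ x ∈ T, ratVal (f n x) ≤ 1 := by
    intro n T hT
    simp only [hfval, Finset.sum_boole]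
    -- Initial segments of one sequence are comparable, so a prefix-free set contains at most one.
    have hcomp : ∀ x ∈ T, ∀ y ∈ T, x = initSeg ω x.length → y = initSeg ω y.length →
        x.length ≤ y.length → x = y := by
      intro x hx y hy hxω hyω hl
      refine hT x hx y hy ?_
      rw [List.prefix_iff_eq_take, hyω, take_initSeg hl]
      exact hxω
    have : (T.filter fun x => Encodable.encode x < n ∧ x = initSeg ω x.length).card ≤ 1 := by
      refine Finset.card_le_one.2 fun x hx y hy => ?_
      rw [Finset.mem_filter] at hx hy
      rcases le_total x.length y.length with h | h
      · exact hcomp x hx.1 y hy.1 hx.2.2 hy.2.2 h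
      · exact (hcomp y hy.1 x hx.1 hy.2.2 hx.2.2 h).symm
    exact_mod_cast this
  obtain ⟨b, hb, hle⟩ := exists_isContinuousSemimeasure_of_approx hf hfin hmono hsum
  refine ⟨b, hb, fun n => ?_⟩
  refine le_trans (le_of_eq ?_) (hle (Encodable.encode (initSeg ω n) + 1) (initSeg ω n))
  rw [hfval, if_pos ⟨Nat.lt_succ_self _, by simp⟩]

theorem tendsto_measureReal_cyl (μ : Measure CantorSeq) [IsProbabilityMeasure μ] {ω : CantorSeq}
    (hω : μ {ω} = 0) : Tendsto (fun n => μ.real (cyl (initSeg ω n))) atTop (𝓝 0) := by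
  have hanti : Antitone fun n => cyl (initSeg ω n) := by
    intro m n h η hη
    simp only [mem_cyl, length_initSeg] at hη ⊢
    rw [← take_initSeg h, hη, take_initSeg h]
  have hi : ⋂ n, cyl (initSeg ω n) = {ω} := by
    refine Set.Subset.antisymm (fun η hη => ?_) ?_
    · refine funext fun n => ?_
      have := Set.mem_iInter.1 hη (n + 1)
      rw [mem_cyl, length_initSeg, initSeg_succ, initSeg_succ] at this
      exact List.singleton_injective (List.append_inj_right' this rfl)
    · rintro _ rfl
      exact Set.mem_iInter.2 fun n => mem_cyl_initSeg _ n
  have h := tendsto_measure_iInter_atTop (μ := μ)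
    (fun n => (measurableSet_cyl (initSeg ω n)).nullMeasurableSet) hanti
    ⟨0, measure_ne_top _ _⟩
  rw [hi, hω] at h
  exact (ENNReal.tendsto_toReal ENNReal.zero_ne_top).comp h

/-! ### Deficiencies and ratios -/

theorem log₂_zero : log₂ 0 = ⊥ := by
  rw [log₂, ENNReal.log_zero, EReal.bot_div_of_pos_ne_top _ (EReal.coe_ne_top _)]
  exact_mod_cast Real.log_pos one_lt_two

theorem log₂_ofReal {t : ℝ} (ht : 0 < t) : log₂ (ENNReal.ofReal t) = (Real.logb 2 t : ℝ) := by
  rw [log₂, ENNReal.log_ofReal_of_pos ht, ← EReal.coe_div, Real.logb]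

theorem log₂_mono : Monotone log₂ := fun s t h =>
  EReal.monotone_div_right_of_nonneg (by exact_mod_cast (Real.log_pos one_lt_two).le)
    (ENNReal.log_monotone h)

theorem log₂_lt_top {t : ℝ≥0∞} (ht : t ≠ ⊤) : log₂ t < ⊤ := by
  rcases eq_or_ne t 0 with rfl | h0
  · rw [log₂_zero]
    exact bot_lt_top
  · rw [← ENNReal.ofReal_toReal ht, log₂_ofReal (ENNReal.toReal_pos h0 ht)]
    exact EReal.coe_lt_top _

theorem exp₂_coe (s : ℝ) : exp₂ s = ENNReal.ofReal (2 ^ s) := by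
  rw [exp₂, ← EReal.coe_mul, EReal.exp_coe, Real.rpow_def_of_pos two_pos, mul_comm]

theorem exp₂_eq_rpow (s : EReal) : exp₂ s = EReal.exp s ^ Real.log 2 := EReal.exp_mul s _

theorem exp₂_mono : Monotone exp₂ := fun s t h => by
  rw [exp₂_eq_rpow, exp₂_eq_rpow]
  exact ENNReal.rpow_le_rpow (EReal.exp_monotone h) (Real.log_pos one_lt_two).le

theorem continuous_exp₂ : Continuous exp₂ := by
  rw [funext exp₂_eq_rpow]
  exact ENNReal.continuous_rpow_const.comp ENNReal.continuous_exp

theorem exp₂_log₂ {t : ℝ≥0∞} (ht : t ≠ ⊤) : exp₂ (log₂ t) = t := by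
  rcases eq_or_ne t 0 with rfl | h0
  · rw [log₂_zero, exp₂_eq_rpow, EReal.exp_bot, ENNReal.zero_rpow_of_pos (Real.log_pos one_lt_two)]
  · have hpos := ENNReal.toReal_pos h0 ht
    rw [← ENNReal.ofReal_toReal ht, log₂_ofReal hpos, exp₂_coe,
      Real.rpow_logb two_pos (by norm_num) hpos]

section Deficiency

variable {μ : Measure CantorSeq} {a : List Bool → ℝ≥0}

theorem measurable_deficiencyA : Measurable (deficiencyA a μ) :=
  Measurable.iSup fun n =>
    measurable_comp_initSeg (fun x => -log₂ (μ (cyl x)) - complexityKA a x) n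

variable [IsProbabilityMeasure μ]

theorem prefixDeficiency_eq {ω : CantorSeq} {n : ℕ} (h : μ (cyl (initSeg ω n)) ≠ 0) :
    prefixDeficiency a μ ω n = log₂ (a (initSeg ω n) / μ (cyl (initSeg ω n))) := by
  have hm := ENNReal.toReal_pos h (measure_ne_top _ _)
  rw [prefixDeficiency, complexityKA, ← ENNReal.ofReal_toReal (measure_ne_top μ (cyl (initSeg ω n))),
    log₂_ofReal hm]
  rcases eq_or_ne (a (initSeg ω n)) 0 with h0 | h0
  · rw [h0, ENNReal.coe_zero, ENNReal.zero_div, log₂_zero, EReal.neg_bot, ← EReal.coe_neg,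
      EReal.sub_top]
  · have ha : (0 : ℝ) < a (initSeg ω n) := NNReal.coe_pos.2 (pos_iff_ne_zero.2 h0)
    rw [← ENNReal.ofReal_coe_nnreal, ← ENNReal.ofReal_div_of_pos hm, log₂_ofReal ha,
      log₂_ofReal (div_pos ha hm), Real.logb_div ha.ne' hm.ne', ← EReal.coe_neg, ← EReal.coe_neg,
      ← EReal.coe_sub]
    congr 1
    ring

theorem ae_deficiencyA_lt_top (ha : IsContinuousSemimeasure a) :
    ∀ᵐ ω ∂μ, deficiencyA a μ ω < ⊤ := by
  filter_upwards [ae_iSup_semimeasure_ratio_lt_top μ ha, ae_measure_cyl_ne_zero μ] with ω h hpos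
  refine lt_of_le_of_lt (iSup_le fun n => ?_) (log₂_lt_top h.ne)
  rw [prefixDeficiency_eq (hpos n)]
  exact log₂_mono (le_iSup (fun n => (a (initSeg ω n) : ℝ≥0∞) / μ (cyl (initSeg ω n))) n)

/-- `exp₂` is monotone and continuous, so it commutes with the limsup and gives the limsup of the
ratios. -/
theorem lintegral_exp₂_deficiencyLimsupA_le (ha : IsContinuousSemimeasure a) :
    ∫⁻ ω, exp₂ (deficiencyLimsupA a μ ω) ∂μ ≤ 1 := by
  refine le_trans (lintegral_mono_ae ?_) (lintegral_limsup_semimeasure_ratio_le μ ha)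
  filter_upwards [ae_measure_cyl_ne_zero μ] with ω hpos
  rw [deficiencyLimsupA, exp₂_mono.map_limsup_of_continuousAt _ continuous_exp₂.continuousAt]
  refine le_of_eq (limsup_congr (Eventually.of_forall fun n => ?_))
  simp only [Function.comp_apply]
  rw [prefixDeficiency_eq (hpos n), exp₂_log₂ (ENNReal.div_ne_top ENNReal.coe_ne_top (hpos n))]

theorem le_deficiencyA {C : ℝ} (hC : 0 < C) {x : List Bool} (hx : 0 < μ.real (cyl x))
    (h : 1 ≤ C * a x) {ω : CantorSeq} (hω : ω ∈ cyl x) :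
    ((Real.logb 2 (1 / (C * μ.real (cyl x))) : ℝ) : EReal) ≤ deficiencyA a μ ω := by
  have hx0 : μ (cyl (initSeg ω x.length)) ≠ 0 := by
    rw [mem_cyl.1 hω]
    intro h0
    simp [measureReal_def, h0] at hx
  refine le_trans ?_ (le_iSup _ x.length)
  rw [prefixDeficiency_eq hx0, mem_cyl.1 hω, ← log₂_ofReal (by positivity)]
  refine log₂_mono ?_
  rw [← ENNReal.ofReal_toReal (measure_ne_top μ (cyl x)), ← measureReal_def,
    ← ENNReal.ofReal_coe_nnreal, ← ENNReal.ofReal_div_of_pos hx]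
  refine ENNReal.ofReal_le_ofReal ?_
  rw [div_le_div_iff₀ (by positivity) hx]
  nlinarith

end Deficiency

/-! ### Divergence of the integral -/

/-- The derivative `1 - 1 / (t ln 2)` is nonnegative for `t ≥ 1 / ln 2`; the threshold 2 needs only
`ln 2 ≥ 1 / 2`. -/
theorem sub_logb_two_mono {s t : ℝ} (hs : 2 ≤ s) (hst : s ≤ t) :
    s - Real.logb 2 s ≤ t - Real.logb 2 t := by
  have hs0 : 0 < s := by linarith
  have ht0 : 0 < t := by linarith
  have hl : (1 / 2 : ℝ) ≤ Real.log 2 := by linarith [Real.log_two_gt_d9]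
  have h1 : Real.log (t / s) ≤ (t - s) * Real.log 2 := by
    calc Real.log (t / s) ≤ t / s - 1 := Real.log_le_sub_one_of_pos (by positivity)
      _ = (t - s) / s := by field_simp
      _ ≤ (t - s) / 2 := div_le_div_of_nonneg_left (by linarith) two_pos hs
      _ ≤ (t - s) * Real.log 2 := by nlinarith
  have h2 : Real.logb 2 t - Real.logb 2 s ≤ t - s := by
    rw [← Real.logb_div ht0.ne' hs0.ne', Real.logb, div_le_iff₀ (Real.log_pos one_lt_two)]
    exact h1
  linarith

/-- A discrete form of `∫ ds / s = ∞`: each term dominates a multiple of `ln sₙ₊₁ - ln sₙ`, and the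
sum telescopes. -/
theorem tsum_slow_decrease_eq_top {m s : ℕ → ℝ} {C : ℝ} (hC : 0 < C) (hm : ∀ n, 0 < m n)
    (hanti : ∀ n, m (n + 1) ≤ m n) (hslow : ∀ n, m n ≤ 3 * m (n + 1))
    (hs : ∀ n, s n = Real.logb 2 (1 / (C * m n))) (hs2 : ∀ n, 2 ≤ s n)
    (hlim : Tendsto s atTop atTop) :
    ∑' n, ENNReal.ofReal (2 ^ (s n - Real.logb 2 (s n))) * ENNReal.ofReal (m n - m (n + 1)) = ⊤ := by
  have hl2 : 0 < Real.log 2 := Real.log_pos one_lt_two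
  have hterm : ∀ n, Real.log 2 / (3 * C) * (Real.log (s (n + 1)) - Real.log (s n)) ≤
      2 ^ (s n - Real.logb 2 (s n)) * (m n - m (n + 1)) := by
    intro n
    have h0 : 0 < s n := by linarith [hs2 n]
    have h1 : 0 < s (n + 1) := by linarith [hs2 (n + 1)]
    have hmn := hm n
    have hmn1 := hm (n + 1)
    have e : (2 : ℝ) ^ (s n - Real.logb 2 (s n)) = 1 / (C * m n * s n) := by
      rw [Real.rpow_sub two_pos, Real.rpow_logb two_pos (by norm_num) h0, hs n,
        Real.rpow_logb two_pos (by norm_num) (by positivity), div_div]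
    have hdiff : s (n + 1) - s n = Real.log (m n / m (n + 1)) / Real.log 2 := by
      rw [hs, hs, ← Real.logb_div (by positivity) (by positivity), Real.logb]
      congr 2
      field_simp
    have hlog : Real.log (s (n + 1)) - Real.log (s n) ≤ (s (n + 1) - s n) / s n := by
      rw [← Real.log_div h1.ne' h0.ne']
      refine (Real.log_le_sub_one_of_pos (by positivity)).trans (le_of_eq ?_)
      field_simp
    -- `ln t ≤ t - 1` produces the denominator `mₙ₊₁`; slow decrease replaces it by `mₙ` at the cost
    -- of the factor 3.
    have hr : Real.log (m n / m (n + 1)) ≤ 3 * ((m n - m (n + 1)) / m n) := by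
      refine (Real.log_le_sub_one_of_pos (by positivity)).trans ?_
      rw [div_sub_one hmn1.ne', ← mul_div_assoc, div_le_div_iff₀ hmn1 hmn]
      nlinarith [hanti n, hslow n]
    calc _ ≤ Real.log 2 / (3 * C) * ((s (n + 1) - s n) / s n) := by gcongr
      _ = Real.log (m n / m (n + 1)) / (3 * C * s n) := by rw [hdiff]; field_simp
      _ ≤ 3 * ((m n - m (n + 1)) / m n) / (3 * C * s n) := by gcongr
      _ = _ := by rw [e]; field_simp
  have ht : Tendsto (fun M => ENNReal.ofReal
      (Real.log 2 / (3 * C) * (Real.log (s M) - Real.log (s 0)))) atTop (𝓝 ⊤) := by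
    refine ENNReal.tendsto_ofReal_atTop.comp ?_
    refine Tendsto.const_mul_atTop (by positivity) ?_
    exact tendsto_atTop_add_const_right _ _ (Real.tendsto_log_atTop.comp hlim)
  refine top_le_iff.1 (le_of_tendsto' ht fun M => ?_)
  refine le_trans ?_ (ENNReal.sum_le_tsum (Finset.range M))
  rw [← Finset.sum_range_sub (fun n => Real.log (s n)), Finset.mul_sum]
  have hnn : ∀ n, 0 ≤ (2 : ℝ) ^ (s n - Real.logb 2 (s n)) * (m n - m (n + 1)) := fun n =>
    mul_nonneg (by positivity) (sub_nonneg.2 (hanti n))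
  refine (ENNReal.ofReal_le_ofReal (Finset.sum_le_sum fun n _ => hterm n)).trans ?_
  rw [ENNReal.ofReal_sum_of_nonneg fun n _ => hnn n]
  refine Finset.sum_le_sum fun n _ => ?_
  rw [ENNReal.ofReal_mul (by positivity)]

theorem lintegral_deficiencyA_eq_top (μ : Measure CantorSeq) [IsProbabilityMeasure μ]
    (hμ : IsComputableMeasure μ) (hna : ∀ ω : CantorSeq, μ {ω} = 0) {a : List Bool → ℝ≥0}
    (ha : IsAPrioriProbability a) :
    ∫⁻ ω in {ω | 1 < deficiencyA a μ ω ∧ deficiencyA a μ ω < ⊤},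
      ENNReal.ofReal
        ((2 : ℝ) ^ ((deficiencyA a μ ω).toReal - Real.logb 2 (deficiencyA a μ ω).toReal)) ∂μ
      = ⊤ := by
  obtain ⟨ξ, hξc, hξ⟩ := exists_computable_slow_path μ hμ
  obtain ⟨b, hb, hb1⟩ := exists_semimeasure_concentrated hξc
  obtain ⟨C, hC⟩ := ha.2 b hb
  have hCa : ∀ n, (1 : ℝ) ≤ C * a (initSeg ξ n) := fun n => by
    exact_mod_cast (hb1 n).trans (hC _)
  have hC0 : (0 : ℝ) < C := by
    refine NNReal.coe_pos.2 (pos_iff_ne_zero.2 fun h => ?_)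
    have := hCa 0
    norm_num [h] at this
  set m : ℕ → ℝ := fun n => μ.real (cyl (initSeg ξ n)) with hm
  set s : ℕ → ℝ := fun n => Real.logb 2 (1 / (C * m n)) with hs
  have hm0 : ∀ n, 0 < m n := fun n => (hξ n).1
  have hlim : Tendsto s atTop atTop := by
    refine (Real.tendsto_logb_atTop one_lt_two).comp ?_
    simp only [one_div]
    refine Tendsto.inv_tendsto_nhdsGT_zero (tendsto_nhdsWithin_iff.2 ⟨?_, ?_⟩)
    · simpa using (tendsto_measureReal_cyl μ (hna ξ)).const_mul (C : ℝ)
    · exact Eventually.of_forall fun n => mul_pos hC0 (hm0 n)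
  -- Beyond `N`, the bound `s ≥ 2` puts the deficiency above 1 and in the range where `t - log t` is
  -- monotone.
  obtain ⟨N, hN⟩ := eventually_atTop.1 (hlim.eventually_ge_atTop 2)
  have hsub : ∀ {i j}, i ≤ j → cyl (initSeg ξ j) ⊆ cyl (initSeg ξ i) := by
    intro i j h η hη
    simp only [mem_cyl, length_initSeg] at hη ⊢
    rw [← take_initSeg h, hη, take_initSeg h]
  have hanti : ∀ n, m (n + 1) ≤ m n := fun n => measureReal_mono (hsub n.le_succ)
  set S : Set CantorSeq := {ω | 1 < deficiencyA a μ ω ∧ deficiencyA a μ ω < ⊤} with hS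
  have hSm : MeasurableSet S :=
    (measurableSet_lt measurable_const measurable_deficiencyA).inter
      (measurableSet_lt measurable_deficiencyA measurable_const)
  -- The sequences that agree with `ξ` on exactly the first `N + n` bits.
  set E : ℕ → Set CantorSeq := fun n => cyl (initSeg ξ (N + n)) \ cyl (initSeg ξ (N + n + 1))
    with hE
  have hEm : ∀ n, MeasurableSet (E n) := fun n => (measurableSet_cyl _).diff (measurableSet_cyl _)
  have hge : ∀ n, ∀ ω ∈ E n, ((s (N + n) : ℝ) : EReal) ≤ deficiencyA a μ ω := fun n ω hω =>
    le_deficiencyA hC0 (hm0 _) (hCa _) hω.1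
  have hμE : ∀ n, μ (S ∩ E n) = ENNReal.ofReal (m (N + n) - m (N + n + 1)) := by
    intro n
    -- Intersecting with `S` removes only a null set, the deficiency being finite almost everywhere.
    have h1 : μ (S ∩ E n) = μ (E n) := by
      refine measure_congr ?_
      filter_upwards [ae_deficiencyA_lt_top (μ := μ) ha.1] with ω hω
      refine propext ⟨fun h => h.2, fun h => ⟨⟨lt_of_lt_of_le ?_ (hge n ω h), hω⟩, h⟩⟩
      have := hN (N + n) (by omega)
      exact_mod_cast (show (1 : ℝ) < s (N + n) by linarith)
    rw [h1, ← ofReal_measureReal, measureReal_sdiff (hsub (Nat.le_succ _)) (measurableSet_cyl _)]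
  have hdisj : Pairwise (Function.onFun Disjoint fun n => S ∩ E n) := by
    refine (pairwise_disjoint_on _).2 fun i j hij => Set.disjoint_left.2 fun ω hi hj => ?_
    exact hi.2.2 (hsub (by omega) hj.2.1)
  refine top_le_iff.1 ?_
  calc (⊤ : ℝ≥0∞) = ∑' n, ENNReal.ofReal (2 ^ (s (N + n) - Real.logb 2 (s (N + n)))) *
        ENNReal.ofReal (m (N + n) - m (N + n + 1)) := by
        refine (tsum_slow_decrease_eq_top (m := fun n => m (N + n)) (s := fun n => s (N + n))
          hC0 (fun n => hm0 _) (fun n => hanti _) (fun n => (hξ _).2) (fun n => rfl)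
          (fun n => hN _ (by omega)) ?_).symm
        exact hlim.comp (tendsto_atTop_mono (fun n => Nat.le_add_left n N) tendsto_id)
    _ ≤ ∑' n, ∫⁻ ω in S ∩ E n, ENNReal.ofReal
        ((2 : ℝ) ^ ((deficiencyA a μ ω).toReal - Real.logb 2 (deficiencyA a μ ω).toReal)) ∂μ := by
        refine ENNReal.tsum_le_tsum fun n => ?_
        rw [← hμE, ← setLIntegral_const]
        refine setLIntegral_mono' (hSm.inter (hEm n)) fun ω hω => ?_
        refine ENNReal.ofReal_le_ofReal (Real.rpow_le_rpow_of_exponent_le one_le_two ?_)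
        refine sub_logb_two_mono (hN _ (by omega)) ?_
        exact EReal.toReal_le_toReal (hge n ω hω.2) (EReal.coe_ne_bot _) hω.1.2.ne
    _ = ∫⁻ ω in ⋃ n, S ∩ E n, ENNReal.ofReal
        ((2 : ℝ) ^ ((deficiencyA a μ ω).toReal - Real.logb 2 (deficiencyA a μ ω).toReal)) ∂μ :=
        (lintegral_iUnion (fun n => hSm.inter (hEm n)) hdisj _).symm
    _ ≤ _ := lintegral_mono_set (Set.iUnion_subset fun n => Set.inter_subset_left)

theorem exists_deficiencyLimsupA_lt (μ : Measure CantorSeq) [IsProbabilityMeasure μ]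
    (hμ : IsComputableMeasure μ) (hna : ∀ ω : CantorSeq, μ {ω} = 0) {a : List Bool → ℝ≥0}
    (ha : IsAPrioriProbability a) (c : ℝ) :
    ∃ (ω : CantorSeq) (d : ℝ), 1 < d ∧ deficiencyA a μ ω = (d : EReal) ∧
      deficiencyLimsupA a μ ω < ((d - Real.logb 2 d - c : ℝ) : EReal) := by
  by_contra! hcon
  refine (lintegral_deficiencyA_eq_top μ hμ hna ha).not_lt ?_
  have hSm : MeasurableSet {ω | 1 < deficiencyA a μ ω ∧ deficiencyA a μ ω < ⊤} :=
    (measurableSet_lt measurable_const measurable_deficiencyA).inter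
      (measurableSet_lt measurable_deficiencyA measurable_const)
  calc _ ≤ ∫⁻ ω in {ω | 1 < deficiencyA a μ ω ∧ deficiencyA a μ ω < ⊤},
        ENNReal.ofReal (2 ^ c) * exp₂ (deficiencyLimsupA a μ ω) ∂μ := by
        refine setLIntegral_mono' hSm fun ω hω => ?_
        have hd : deficiencyA a μ ω = ((deficiencyA a μ ω).toReal : EReal) :=
          (EReal.coe_toReal hω.2.ne (bot_lt_of_lt hω.1).ne').symm
        have h1 : 1 < (deficiencyA a μ ω).toReal := by
          have := hω.1
          rw [hd] at this
          exact_mod_cast this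
        have h2 := exp₂_mono (hcon ω _ h1 hd)
        rw [exp₂_coe] at h2
        refine le_trans (le_of_eq ?_) (mul_le_mul_right h2 _)
        rw [← ENNReal.ofReal_mul (by positivity), ← Real.rpow_add two_pos]
        congr 2
        ring
    _ ≤ ∫⁻ ω, ENNReal.ofReal (2 ^ c) * exp₂ (deficiencyLimsupA a μ ω) ∂μ :=
        setLIntegral_le_lintegral _ _
    _ = ENNReal.ofReal (2 ^ c) * ∫⁻ ω, exp₂ (deficiencyLimsupA a μ ω) ∂μ :=
        lintegral_const_mul' _ _ ENNReal.ofReal_ne_top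
    _ < ⊤ := ENNReal.mul_lt_top ENNReal.ofReal_lt_top
        ((lintegral_exp₂_deficiencyLimsupA_le ha.1).trans_lt ENNReal.one_lt_top)

theorem mainTheorem1 (μ : Measure CantorSeq) [IsProbabilityMeasure μ]
    (hμ : IsComputableMeasure μ) (hna : ∀ ω : CantorSeq, μ {ω} = 0) :
    (∃ a : List Bool → ℝ≥0, IsAPrioriProbability a) ∧
    ∀ a : List Bool → ℝ≥0, IsAPrioriProbability a →
      (∀ c : ℝ, ∃ (ω : CantorSeq) (d : ℝ), 1 < d ∧ deficiencyA a μ ω = (d : EReal) ∧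
        deficiencyLimsupA a μ ω < ((d - Real.logb 2 d - c : ℝ) : EReal)) ∧
      (∫⁻ ω, exp₂ (deficiencyLimsupA a μ ω) ∂μ < ⊤) ∧
      (∫⁻ ω in {ω | 1 < deficiencyA a μ ω ∧ deficiencyA a μ ω < ⊤},
        ENNReal.ofReal
          ((2 : ℝ) ^ ((deficiencyA a μ ω).toReal - Real.logb 2 (deficiencyA a μ ω).toReal)) ∂μ
        = ⊤) :=
  ⟨exists_isAPrioriProbability, fun _ ha =>
    ⟨exists_deficiencyLimsupA_lt μ hμ hna ha,
      (lintegral_exp₂_deficiencyLimsupA_le ha.1).trans_lt ENNReal.one_lt_top,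
      lintegral_deficiencyA_eq_top μ hμ hna ha⟩⟩
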